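/- Let $d,n\ge 1$ be integers and $[n]=\{1,\dots,n\}$. Tensors $\mathcal C=[c_{i_1,\dots,i_d}]\in\otimes^d\mathbb R^n$ have real entries; put $\langle \mathcal C,\mathcal U\rangle=\sum c_{i_1,\dots,i_d}u_{i_1,\dots,i_d}$, $\|\mathcal C\|_1=\sum|c_{i_1,\dots,i_d}|$ and $\|\mathcal C\|_\infty=\max|c_{i_1,\dots,i_d}|$. The $j$-th marginal $\mathbf s_j(\mathcal C)\in\mathbb R^n$ has the entries $s_{i,j}(\mathcal C)=\sum_{i_1,\dots,i_d:\ i_j=i}c_{i_1,\dots,i_d}$. Let $\mathbf p_1,\dots,\mathbf p_d\in\mathbb R^n$ be probability vectors with positive entries $p_{i,j}$, $P=(\mathbf p_1,\dots,\mathbf p_d)$, and $$\mathrm U(P)=\{\mathcal U\in\otimes^d\mathbb R^n:\ \mathcal U\ge 0,\ \mathbf s_j(\mathcal U)=\mathbf p_j \text{ for } j=1,\dots,d\},\qquad \tau(\mathcal C,P)=\min\{\langle\mathcal C,\mathcal U\rangle:\ \mathcal U\in\mathrm U(P)\}.$$ Sinkhorn algorithm. For a positive tensor $\mathcal A$ let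 $\mathcal A_0=\mathcal A/\|\mathcal A\|_1$ and $\delta_j(\mathcal F)=\bigl\|\mathbf s_j(\mathcal F)-\frac{\langle\mathbf s_j(\mathcal F),\mathbf p_j\rangle}{\|\mathbf p_j\|_2^2}\mathbf p_j\bigr\|_1$. Given $\mathcal A_k$, choose any $\ell(k)\in\{1,\dots,d\}$ that maximizes $\delta_j(\mathcal A_k)$ over $j$, and let $\mathcal A_{k+1}$ be obtained by rescaling the mode $l=\ell(k)$: the entry at $(i_1,\dots,i_d)$ is multiplied by $p_{i_l,l}/s_{i_l,l}(\mathcal A_k)$. (Equivalently, $\mathcal A_k=[\exp(\sum_j x^{(k)}_{i_j,j})\,a_{i_1,\dots,i_d,0}]$, where $x^{(0)}=0$ and the step adds $\log p_{i,l}-\log s_{i,l}(\mathcal A_k)$ to $x^{(k)}_{i,l}$ for $i\in[n]$.) For $\varepsilon>0$ let $k^{stop}$ be the least $k\ge 0$ such that $\max_j\delta_j(\mathcal A_k)<\varepsilon$. Replacement algorithm. For a positive tensor $\mathcal F$ with $\|\mathcal F\|_1=1$ let $\mathcal F_0=\mathcal F$ and, for $j=1,\dots,d$, let $\mathcal F_j$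 be obtained from $\mathcal F_{j-1}$ by multiplying the entry at $(i_1,\dots,i_d)$ by $\min(p_{i_j,j}/s_{i_j,j}(\mathcal F_{j-1}),1)$. Let $\mathcal G=\mathcal F_d$, $\mathbf q_j=\mathbf s_j(\mathcal G)$ and $h'=\|\mathbf q_1\|_1$. The output is $$\mathcal B=\mathcal G+\frac{1}{(1-h')^{d-1}}\otimes_{j=1}^d(\mathbf p_j-\mathbf q_j),$$ which is read as $\mathcal B=\mathcal G$ if $h'=1$ (then $\mathbf q_j=\mathbf p_j$ for all $j$). Theorem. Let $\mathcal C\in\otimes^d\mathbb R^n$ and assume that $n\ge 2$ or $\mathcal C\ne 0$. Let $\lambda>0$, $\varepsilon\in(0,1/2)$, and let $\mathcal A=\exp(-\lambda\mathcal C)$ be the entrywise exponential. Then, for every run of the Sinkhorn algorithm for $\mathcal A$, $k^{stop}$ exists; the tensor $\mathcal B$ obtained from $\mathcal A_{k^{stop}}$ by the replacement algorithm lies in $\mathrm U(P)$; and $$\langle\mathcal C,\mathcal B\rangle<\tau(\mathcal C,P)+\frac{d\log n}{\lambda}+8d\,\|\mathcal C\|_\infty\,\varepsilon .$$ -/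

import Mathlib

open scoped BigOperators

noncomputable section

namespace TensorOT

/-- The space `⊗^d ℝ^n` of real `d`-mode tensors, given by their entries. Its norm `‖C‖` (the
sup norm of a finite product) is the maximum of the absolute values of the entries. -/
abbrev Tensor (d n : ℕ) : Type := (Fin d → Fin n) → ℝ

/-- The `ℓ¹`-norm of a finitely indexed family: a vector or a tensor. -/
def l1Norm {ι : Type} [Fintype ι] (x : ι → ℝ) : ℝ := ∑ i, |x i|

/-- The inner product `⟨C, U⟩` of two tensors (sum of products of entries). -/
def pairing {d n : ℕ} (C U : Tensor d n) : ℝ := ∑ i, C i * U i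

/-- The `j`-th marginal `s_j(A)`: sum of the entries over all indices but the `j`-th one. -/
def marginal {d n : ℕ} (j : Fin d) (A : Tensor d n) : Fin n → ℝ :=
  fun a => ∑ i : Fin d → Fin n with i j = a, A i

/-- A probability vector with positive entries. -/
def IsPosProb {n : ℕ} (p : Fin n → ℝ) : Prop := (∀ a, 0 < p a) ∧ ∑ a, p a = 1

/-- The transport polytope `U(P)`: nonnegative tensors whose `j`-th marginal is `P j`. -/
def polytope {d n : ℕ} (P : Fin d → Fin n → ℝ) : Set (Tensor d n) :=
  {U | (∀ i, 0 ≤ U i) ∧ ∀ j, marginal j U = P j}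

/-- The value `τ(C, P)` of the tensor optimal transport problem, the minimum of `⟨C, U⟩` over
`U(P)` (the minimum is attained, see `isLeast_otValue`). -/
def otValue {d n : ℕ} (C : Tensor d n) (P : Fin d → Fin n → ℝ) : ℝ :=
  sInf (pairing C '' polytope P)

/-- The entrywise exponential. -/
def texp {d n : ℕ} (A : Tensor d n) : Tensor d n := fun i => Real.exp (A i)

/-- The scaling `[exp(∑_j x_{i_j, j}) a_{i_1, …, i_d}]` of the tensor `A`. -/
def scale {d n : ℕ} (A : Tensor d n) (X : Fin d → Fin n → ℝ) : Tensor d n :=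
  fun i => Real.exp (∑ j, X j (i j)) * A i

/-- `‖s_j(A) - (⟨s_j(A), p_j⟩ / ‖p_j‖²) p_j‖₁`. -/
def deviation {d n : ℕ} (P : Fin d → Fin n → ℝ) (A : Tensor d n) (j : Fin d) : ℝ :=
  l1Norm (marginal j A - ((marginal j A ⬝ᵥ P j) / (P j ⬝ᵥ P j)) • P j)

/-- The correction vector `log p_j - log s_j(A)`. -/
def logRatio {d n : ℕ} (P : Fin d → Fin n → ℝ) (A : Tensor d n) (j : Fin d) : Fin n → ℝ :=
  fun a => Real.log (P j a) - Real.log (marginal j A a)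

/-- `X` and `ℓ` form a run of the Sinkhorn algorithm started at the tensor `A`: `X k` are the
iterates (the `k`-th tensor is `scale A (X k)`), and `ℓ k` is the mode that is rescaled in the
`k`-th step, any mode of largest deviation. -/
structure IsSinkhornRun {d n : ℕ} (P : Fin d → Fin n → ℝ) (A : Tensor d n)
    (X : ℕ → Fin d → Fin n → ℝ) (ℓ : ℕ → Fin d) : Prop where
  init : X 0 = 0
  argmax : ∀ k j, deviation P (scale A (X k)) j ≤ deviation P (scale A (X k)) (ℓ k)
  step : ∀ k, X (k + 1) =
    Function.update (X k) (ℓ k) (logRatio P (scale A (X k)) (ℓ k) + X k (ℓ k))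

/-- The stopping criterion: the largest deviation is less than `ε`. -/
def StopsAt {d n : ℕ} (P : Fin d → Fin n → ℝ) (ε : ℝ) (A : Tensor d n) : Prop :=
  ∀ j, deviation P A j < ε

/-- One step of the replacement algorithm:
the entry at `i` is multiplied by `min(p_{i_j, j} / s_{i_j, j}(F), 1)`. -/
def capMode {d n : ℕ} (P : Fin d → Fin n → ℝ) (j : Fin d) (F : Tensor d n) : Tensor d n :=
  fun i => min (P j (i j) / marginal j F (i j)) 1 * F i

/-- The tensor obtained from `F` by capping the first `m` modes, one after the other. -/
def capped {d n : ℕ} (P : Fin d → Fin n → ℝ) (F : Tensor d n) : ℕ → Tensor d n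
  | 0 => F
  | m + 1 => if h : m < d then capMode P ⟨m, h⟩ (capped P F m) else capped P F m

/-- The output `G + (h - h')^{-(d-1)} ⊗_j (p_j - s_j(G))` of the replacement algorithm, where `G`
is `F` with all modes capped, and `h`, `h'` are the `ℓ¹`-norms of `p_1` and `s_1(G)` (for `d ≥ 1`
and `h = h'`, when `s_j(G) = p_j` for all `j`, this is `G`). -/
def replacement {d n : ℕ} [NeZero d] (P : Fin d → Fin n → ℝ) (F : Tensor d n) : Tensor d n :=
  let G := capped P F d
  fun i => G i + (1 / (l1Norm (P 0) - l1Norm (marginal 0 G)) ^ (d - 1)) *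
    ∏ j, (P j (i j) - marginal j G (i j))

theorem sum_marginal {d n : ℕ} (j : Fin d) (A : Tensor d n) :
    ∑ a, marginal j A a = ∑ i, A i := by
  unfold marginal
  exact Finset.sum_fiberwise Finset.univ (fun i : Fin d → Fin n => i j) A

theorem prod_mem_polytope {d n : ℕ} {P : Fin d → Fin n → ℝ} (hP : ∀ j, IsPosProb (P j)) :
    (fun i => ∏ j, P j (i j)) ∈ polytope P := by
  refine ⟨fun i => Finset.prod_nonneg fun j _ => ((hP j).1 _).le, fun j => ?_⟩
  funext a
  have h := Finset.prod_univ_sum (fun k : Fin d => if k = j then {a} else (Finset.univ : Finset (Fin n)))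
    (fun k b => P k b)
  have hs : (Fintype.piFinset fun k : Fin d =>
      if k = j then {a} else (Finset.univ : Finset (Fin n))) =
      Finset.univ.filter (fun i : Fin d → Fin n => i j = a) := by
    ext i
    simp only [Fintype.mem_piFinset, Finset.mem_filter, Finset.mem_univ, true_and]
    constructor
    · intro hi
      simpa using hi j
    · intro hi k
      by_cases hk : k = j
      · subst hk; simp [hi]
      · simp [hk]
  rw [hs] at h
  unfold marginal
  rw [← h, Finset.prod_eq_single j]
  · simp
  · intro k _ hk
    simp [hk, (hP k).2]
  · simp

theorem isLeast_otValue {d n : ℕ} [NeZero d] (C : Tensor d n) {P : Fin d → Fin n → ℝ}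
    (hP : ∀ j, IsPosProb (P j)) : IsLeast (pairing C '' polytope P) (otValue C P) := by
  have hcont : Continuous (pairing C) := by unfold pairing; fun_prop
  have hclosed : IsClosed (polytope P) := by
    have h1 : IsClosed {U : Tensor d n | ∀ i, 0 ≤ U i} := by
      simp only [Set.ofPred_forall]
      exact isClosed_iInter fun i => isClosed_le continuous_const (continuous_apply i)
    have h2 : IsClosed {U : Tensor d n | ∀ j, marginal j U = P j} := by
      simp only [Set.ofPred_forall]
      refine isClosed_iInter fun j => isClosed_eq ?_ continuous_const
      unfold marginal
      fun_prop
    exact h1.inter h2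
  have hsub : polytope P ⊆ Set.Icc (0 : Tensor d n) 1 := by
    intro U hU
    refine ⟨fun i => hU.1 i, fun i => ?_⟩
    have h := sum_marginal 0 U
    rw [hU.2 0, (hP 0).2] at h
    rw [Pi.one_apply, h]
    exact Finset.single_le_sum (fun k _ => hU.1 k) (Finset.mem_univ i)
  have hcomp : IsCompact (polytope P) := isCompact_Icc.of_isClosed_subset hclosed hsub
  exact (hcomp.image hcont).isLeast_sInf ⟨_, Set.mem_image_of_mem _ (prod_mem_polytope hP)⟩

end TensorOT

end

namespace TensorOT

open Finset

/-! ### Marginals and the pairing. -/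

section Marginals

variable {d n : ℕ}

/-! Let F be the Sinkhorn tensor at the stopping time and Q its marginals. Stopping forces `‖Q j - P
j‖₁ ≤ 2ε` (`l1Norm_sub_le_two_mul`), so the replacement algorithm moves F into U(P) at ℓ¹-cost at
most 2dε (`replacement_spec`). Run with target Q instead of P, it moves an optimal U of U(P) to some
V in U(Q) at the same cost. Now log F is -λC plus a constant and a separable function, and F and V
have the same marginals, so λ(⟨C,F⟩ - ⟨C,V⟩) = ∑ V log F - ∑ F log F ≤ d log n (`pairing_scale_le`).
Adding up, ⟨C,B⟩ ≤ τ + d log n / λ + 4d‖C‖ε.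

Termination: a step that rescales mode l raises the dual objective ∑ ⟨p_j, x_j⟩ by the relative
entropy of p_l with respect to the current marginal (`dual_step`). By a weak Pinsker inequality this
gain is bounded below as long as some deviation is at least ε, while the objective is bounded above
(`dual_le`). -/

theorem sum_mul_comp_eval (j : Fin d) (U : Tensor d n) (x : Fin n → ℝ) :
    ∑ i, U i * x (i j) = ∑ a, marginal j U a * x a := by
  rw [← sum_fiberwise univ (fun i : Fin d → Fin n => i j)]
  refine sum_congr rfl fun a _ => ?_
  rw [marginal, sum_mul]
  refine sum_congr rfl fun i hi => ?_
  rw [(mem_filter.mp hi).2]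

/-- A separable function integrates against a tensor through the marginals of the tensor. -/
theorem sum_mul_separable (U : Tensor d n) (x : Fin d → Fin n → ℝ) :
    ∑ i, U i * ∑ j, x j (i j) = ∑ j, ∑ a, marginal j U a * x j a := by
  simp_rw [mul_sum]
  rw [sum_comm]
  exact sum_congr rfl fun j _ => sum_mul_comp_eval j U (x j)

theorem marginal_comp_mul (j : Fin d) (f : Fin n → ℝ) (U : Tensor d n) (a : Fin n) :
    marginal j (fun i => f (i j) * U i) a = f a * marginal j U a := by
  unfold marginal
  rw [mul_sum]
  refine sum_congr rfl fun i hi => ?_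
  simp only [(mem_filter.mp hi).2]

theorem marginal_const_mul (j : Fin d) (c : ℝ) (U : Tensor d n) (a : Fin n) :
    marginal j (fun i => c * U i) a = c * marginal j U a :=
  marginal_comp_mul j (fun _ => c) U a

theorem marginal_add (j : Fin d) (U V : Tensor d n) (a : Fin n) :
    marginal j (fun i => U i + V i) a = marginal j U a + marginal j V a := by
  unfold marginal
  exact sum_add_distrib

theorem marginal_mono (j : Fin d) {U V : Tensor d n} (h : ∀ i, U i ≤ V i) (a : Fin n) :
    marginal j U a ≤ marginal j V a :=
  sum_le_sum fun i _ => h i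

theorem marginal_nonneg (j : Fin d) {U : Tensor d n} (h : ∀ i, 0 ≤ U i) (a : Fin n) :
    0 ≤ marginal j U a :=
  sum_nonneg fun i _ => h i

theorem marginal_pos (j : Fin d) {U : Tensor d n} (h : ∀ i, 0 < U i) (a : Fin n) :
    0 < marginal j U a :=
  sum_pos (fun i _ => h i) ⟨fun _ => a, by simp⟩

/-- The marginals of a rank-one tensor. -/
theorem marginal_prod (v : Fin d → Fin n → ℝ) (j : Fin d) (a : Fin n) :
    marginal j (fun i => ∏ k, v k (i k)) a = v j a * ∏ k ∈ univ.erase j, ∑ b, v k b := by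
  -- Expand the product of sums with the range of mode j restricted to `{a}`: the resulting index
  -- box is the fiber over `a`.
  have h := prod_univ_sum
    (fun k : Fin d => if k = j then {a} else (univ : Finset (Fin n))) (fun k b => v k b)
  have hs : (Fintype.piFinset fun k : Fin d =>
      if k = j then {a} else (univ : Finset (Fin n))) =
      univ.filter (fun i : Fin d → Fin n => i j = a) := by
    ext i
    simp only [Fintype.mem_piFinset, mem_filter, mem_univ, true_and]
    constructor
    · intro hi
      simpa using hi j
    · intro hi k
      by_cases hk : k = j
      · subst hk; simp [hi]
      · simp [hk]
  rw [hs] at h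
  unfold marginal
  rw [← h, ← mul_prod_erase univ _ (mem_univ j)]
  congr 1
  · simp
  · refine prod_congr rfl fun k hk => ?_
    rw [if_neg (ne_of_mem_erase hk)]

theorem pairing_sub_le (C U V : Tensor d n) :
    pairing C U - pairing C V ≤ ‖C‖ * l1Norm (U - V) := by
  unfold pairing l1Norm
  rw [← sum_sub_distrib, mul_sum]
  refine sum_le_sum fun i _ => ?_
  have h1 : |C i| ≤ ‖C‖ := norm_le_pi_norm C i
  calc C i * U i - C i * V i = C i * (U i - V i) := by ring
    _ ≤ |C i * (U i - V i)| := le_abs_self _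
    _ = |C i| * |U i - V i| := abs_mul _ _
    _ ≤ ‖C‖ * |(U - V) i| := mul_le_mul_of_nonneg_right h1 (abs_nonneg _)

end Marginals

/-! ### The replacement algorithm. -/

section Replacement

variable {d n : ℕ} {P : Fin d → Fin n → ℝ}

theorem capMode_le (j : Fin d) {F : Tensor d n} (hF : ∀ i, 0 ≤ F i) (i : Fin d → Fin n) :
    capMode P j F i ≤ F i :=
  mul_le_of_le_one_left (hF i) (min_le_right _ _)

theorem capMode_nonneg (hP : ∀ j, IsPosProb (P j)) (j : Fin d) {F : Tensor d n}
    (hF : ∀ i, 0 ≤ F i) (i : Fin d → Fin n) : 0 ≤ capMode P j F i :=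
  mul_nonneg (le_min (div_nonneg ((hP j).1 _).le (marginal_nonneg j hF _)) zero_le_one) (hF i)

theorem marginal_capMode (hP : ∀ j, IsPosProb (P j)) (j : Fin d) {F : Tensor d n}
    (hF : ∀ i, 0 ≤ F i) (a : Fin n) :
    marginal j (capMode P j F) a = min (P j a) (marginal j F a) := by
  have h := marginal_comp_mul j (fun b => min (P j b / marginal j F b) 1) F a
  unfold capMode
  rw [h]
  rcases (marginal_nonneg j hF a).eq_or_lt with h0 | h0
  · rw [← h0, mul_zero, min_eq_right ((hP j).1 a).le]
  · rw [min_mul_of_nonneg _ _ h0.le, div_mul_cancel₀ _ h0.ne', one_mul]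

theorem capped_succ (F : Tensor d n) {m : ℕ} (h : m < d) :
    capped P F (m + 1) = capMode P ⟨m, h⟩ (capped P F m) := by
  simp [capped, h]

theorem capped_succ_of_le (F : Tensor d n) {m : ℕ} (h : d ≤ m) :
    capped P F (m + 1) = capped P F m := by
  simp [capped, not_lt.mpr h]

theorem capped_nonneg (hP : ∀ j, IsPosProb (P j)) {F : Tensor d n} (hF : ∀ i, 0 ≤ F i) (m : ℕ) :
    ∀ i, 0 ≤ capped P F m i := by
  induction m with
  | zero => exact hF
  | succ m ih =>
    rcases lt_or_ge m d with h | h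
    · rw [capped_succ F h]; exact capMode_nonneg hP _ ih
    · rw [capped_succ_of_le F h]; exact ih

theorem capped_succ_le (hP : ∀ j, IsPosProb (P j)) {F : Tensor d n} (hF : ∀ i, 0 ≤ F i) (m : ℕ)
    (i : Fin d → Fin n) : capped P F (m + 1) i ≤ capped P F m i := by
  rcases lt_or_ge m d with h | h
  · rw [capped_succ F h]; exact capMode_le _ (capped_nonneg hP hF m) i
  · rw [capped_succ_of_le F h]

theorem capped_le (hP : ∀ j, IsPosProb (P j)) {F : Tensor d n} (hF : ∀ i, 0 ≤ F i) (m : ℕ)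
    (i : Fin d → Fin n) : capped P F m i ≤ F i :=
  antitone_nat_of_succ_le (f := fun m => capped P F m i)
    (fun m => capped_succ_le hP hF m i) (Nat.zero_le m)

/-- Capping mode j enforces the bound, and later caps only decrease entries. -/
theorem marginal_capped_le (hP : ∀ j, IsPosProb (P j)) {F : Tensor d n} (hF : ∀ i, 0 ≤ F i)
    (j : Fin d) (a : Fin n) : marginal j (capped P F d) a ≤ P j a := by
  calc marginal j (capped P F d) a ≤ marginal j (capped P F (j + 1)) a :=
        marginal_mono j (fun i => antitone_nat_of_succ_le (f := fun m => capped P F m i)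
          (fun m => capped_succ_le hP hF m i) j.isLt) a
    _ = min (P j a) (marginal j (capped P F j) a) := by
        rw [capped_succ F j.isLt]; exact marginal_capMode hP j (capped_nonneg hP hF j) a
    _ ≤ P j a := min_le_left _ _

/-- Capping a mode removes at most half of the `ℓ¹`-distance of the marginals. -/
theorem sum_sub_capped_le (hP : ∀ j, IsPosProb (P j)) {F : Tensor d n} (hF : ∀ i, 0 ≤ F i)
    (hF1 : ∑ i, F i = 1) {η : ℝ} (hη : ∀ j, l1Norm (marginal j F - P j) ≤ η) {m : ℕ}
    (hm : m ≤ d) : 1 - ∑ i, capped P F m i ≤ m * (η / 2) := by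
  induction m with
  | zero => simp [capped, hF1]
  | succ m ih =>
    have hmd : m < d := hm
    set j : Fin d := ⟨m, hmd⟩
    set H := capped P F m with hH
    have hH0 : ∀ i, 0 ≤ H i := capped_nonneg hP hF m
    -- The mass removed is the positive part of `marginal j H - P j`, at most that of `marginal j F
    -- - P j` since H ≤ F. The latter is half the ℓ¹-distance, because both vectors sum to one.
    have hstep : ∑ i, H i - ∑ i, capped P F (m + 1) i ≤ η / 2 := by
      rw [capped_succ F hmd, ← sum_marginal j, ← sum_marginal j, ← sum_sub_distrib]
      calc ∑ a, (marginal j H a - marginal j (capMode P j H) a)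
          ≤ ∑ a, (|(marginal j F - P j) a| + (marginal j F a - P j a)) / 2 := by
            refine sum_le_sum fun a _ => ?_
            rw [marginal_capMode hP j hH0, Pi.sub_apply]
            have h1 := marginal_mono j (capped_le hP hF m) a
            have h2 := le_abs_self (marginal j F a - P j a)
            have h3 := neg_abs_le (marginal j F a - P j a)
            rw [← hH] at h1
            rcases min_cases (P j a) (marginal j H a) with ⟨h, _⟩ | ⟨h, _⟩ <;> rw [h] <;> linarith
        _ = l1Norm (marginal j F - P j) / 2 := by
            rw [← sum_div, sum_add_distrib, sum_sub_distrib, sum_marginal, hF1, (hP j).2, l1Norm]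
            ring
        _ ≤ η / 2 := by linarith [hη j]
    have := ih hmd.le
    push_cast
    linarith

variable [NeZero d]

theorem l1Norm_sub_l1Norm_marginal (hP : ∀ j, IsPosProb (P j)) {G : Tensor d n}
    (hG : ∀ i, 0 ≤ G i) : l1Norm (P 0) - l1Norm (marginal 0 G) = 1 - ∑ i, G i := by
  unfold l1Norm
  rw [← (hP 0).2, ← sum_marginal 0 G]
  congr 1
  · exact sum_congr rfl fun a _ => abs_of_pos ((hP 0).1 a)
  · exact sum_congr rfl fun a _ => abs_of_nonneg (marginal_nonneg 0 hG a)

/-- The replacement algorithm produces a point of the polytope near its input. -/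
theorem replacement_spec (hP : ∀ j, IsPosProb (P j)) {F : Tensor d n} (hF : ∀ i, 0 ≤ F i)
    (hF1 : ∑ i, F i = 1) {η : ℝ} (hη : ∀ j, l1Norm (marginal j F - P j) ≤ η) :
    replacement P F ∈ polytope P ∧ l1Norm (replacement P F - F) ≤ d * η := by
  set G := capped P F d with hG
  have hG0 : ∀ i, 0 ≤ G i := capped_nonneg hP hF d
  have hGF : ∀ i, G i ≤ F i := capped_le hP hF d
  set r : ℝ := 1 - ∑ i, G i with hr
  have hr0 : 0 ≤ r := by
    have := sum_le_sum fun i (_ : i ∈ univ) => hGF i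
    linarith
  have hrη : r ≤ d * (η / 2) := sum_sub_capped_le hP hF hF1 hη le_rfl
  set v : Fin d → Fin n → ℝ := fun j a => P j a - marginal j G a with hv
  have hv0 : ∀ j a, 0 ≤ v j a := fun j a => sub_nonneg.mpr (marginal_capped_le hP hF j a)
  have hvr : ∀ j, ∑ a, v j a = r := fun j => by
    rw [hv, sum_sub_distrib, (hP j).2, sum_marginal]
  set T : Tensor d n := fun i => 1 / r ^ (d - 1) * ∏ j, v j (i j) with hT
  have hT0 : ∀ i, 0 ≤ T i := fun i =>
    mul_nonneg (by positivity) (prod_nonneg fun j _ => hv0 j _)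
  have hrep : replacement P F = fun i => G i + T i := by
    funext i
    simp only [replacement, ← hG, l1Norm_sub_l1Norm_marginal hP hG0, ← hr, hT, hv]
  have hTv : ∀ j a, marginal j T a = v j a := fun j a => by
    rw [hT, marginal_const_mul, marginal_prod, prod_congr rfl fun k _ => hvr k, prod_const,
      card_erase_of_mem (mem_univ j), card_univ, Fintype.card_fin]
    -- If no mass is missing, every `v j a` vanishes, so the value of `1 / r ^ (d - 1)` is
    -- irrelevant.
    rcases hr0.eq_or_lt with h | h
    · have h0 : v j a = 0 := by
        refine (sum_eq_zero_iff_of_nonneg fun b _ => hv0 j b).mp ?_ a (mem_univ a)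
        rw [hvr, ← h]
      simp [h0]
    · have := pow_pos h (d - 1)
      field_simp
  refine ⟨?_, ?_⟩
  · rw [hrep]
    refine ⟨fun i => add_nonneg (hG0 i) (hT0 i), fun j => funext fun a => ?_⟩
    rw [marginal_add, hTv]
    simp [hv]
  · have hTr : ∑ i, T i = r := by
      rw [← sum_marginal 0, ← hvr 0]
      exact sum_congr rfl fun a _ => hTv 0 a
    -- The correction T and the removed part F - G each have mass r.
    calc l1Norm (replacement P F - F) ≤ ∑ i, (T i + (F i - G i)) := by
          refine sum_le_sum fun i _ => ?_
          rw [hrep, Pi.sub_apply, abs_le]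
          constructor <;> linarith [hT0 i, hGF i]
      _ = 2 * r := by
          rw [sum_add_distrib, sum_sub_distrib, hTr, hF1, hr]; ring
      _ ≤ d * η := by linarith

end Replacement

/-! ### Deviation, ℓ¹-distance and relative entropy. -/

section Deviation

variable {n : ℕ}

theorem l1Norm_sub_comm (x y : Fin n → ℝ) : l1Norm (x - y) = l1Norm (y - x) :=
  sum_congr rfl fun _ _ => abs_sub_comm _ _

theorem l1Norm_add_le (x y : Fin n → ℝ) : l1Norm (x + y) ≤ l1Norm x + l1Norm y := by
  unfold l1Norm
  rw [← sum_add_distrib]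
  exact sum_le_sum fun a _ => abs_add_le _ _

theorem IsPosProb.le_one {p : Fin n → ℝ} (hp : IsPosProb p) (a : Fin n) : p a ≤ 1 :=
  hp.2 ▸ single_le_sum (fun b _ => (hp.1 b).le) (mem_univ a)

theorem IsPosProb.l1Norm_smul {p : Fin n → ℝ} (hp : IsPosProb p) (c : ℝ) :
    l1Norm (c • p) = |c| := by
  have h : ∀ a, |(c • p) a| = |c| * p a := fun a => by
    rw [Pi.smul_apply, smul_eq_mul, abs_mul, abs_of_pos (hp.1 a)]
  unfold l1Norm
  rw [sum_congr rfl fun a _ => h a, ← mul_sum, hp.2, mul_one]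

theorem IsPosProb.one_le_card_mul_dotProduct {p : Fin n → ℝ} (hp : IsPosProb p) :
    1 ≤ n * (p ⬝ᵥ p) := by
  have h := sq_sum_le_card_mul_sum_sq (s := univ) (f := p)
  rw [hp.2, card_univ, Fintype.card_fin, one_pow] at h
  simpa [dotProduct, sq] using h

/-- The distance to `p` of a vector of total mass one is at most twice its distance to any
multiple of `p`. -/
theorem l1Norm_sub_le_two_mul {p s : Fin n → ℝ} (hp : IsPosProb p) (hs : ∑ a, s a = 1) (c : ℝ) :
    l1Norm (s - p) ≤ 2 * l1Norm (s - c • p) := by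
  have h1 : |c - 1| ≤ l1Norm (s - c • p) := by
    have : ∑ a, (s - c • p) a = 1 - c := by
      simp only [Pi.sub_apply, Pi.smul_apply, smul_eq_mul, sum_sub_distrib, ← mul_sum, hs, hp.2,
        mul_one]
    rw [abs_sub_comm, ← this]
    exact abs_sum_le_sum_abs _ _
  have h2 : s - p = (s - c • p) + (c - 1) • p := by rw [sub_smul, one_smul]; abel
  have h3 := l1Norm_add_le (s - c • p) ((c - 1) • p)
  rw [← h2, hp.l1Norm_smul] at h3
  linarith

/-- Converts a large deviation into a large distance to p, as termination requires. The factor n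
comes from ⟨p,p⟩ ≥ 1/n (Cauchy–Schwarz). -/
theorem l1Norm_sub_proj_le {p s : Fin n → ℝ} (hp : IsPosProb p) :
    l1Norm (s - ((s ⬝ᵥ p) / (p ⬝ᵥ p)) • p) ≤ (1 + n) * l1Norm (s - p) := by
  have hpp := hp.one_le_card_mul_dotProduct
  have hpos : 0 < p ⬝ᵥ p := by
    by_contra h
    have := mul_nonpos_of_nonneg_of_nonpos (Nat.cast_nonneg (α := ℝ) n) (not_lt.mp h)
    linarith
  set c := (s ⬝ᵥ p) / (p ⬝ᵥ p) with hc
  have hdot : |(p - s) ⬝ᵥ p| ≤ l1Norm (s - p) := by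
    rw [l1Norm_sub_comm]
    refine (abs_sum_le_sum_abs _ _).trans (sum_le_sum fun a _ => ?_)
    rw [abs_mul, abs_of_pos (hp.1 a)]
    exact mul_le_of_le_one_right (abs_nonneg _) (hp.le_one a)
  have h1 : |1 - c| ≤ n * l1Norm (s - p) := by
    have : 1 - c = ((p - s) ⬝ᵥ p) / (p ⬝ᵥ p) := by
      rw [sub_dotProduct, hc]; field_simp
    rw [this, abs_div, abs_of_pos hpos, div_le_iff₀ hpos]
    calc |(p - s) ⬝ᵥ p| ≤ l1Norm (s - p) * 1 := by rw [mul_one]; exact hdot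
      _ ≤ l1Norm (s - p) * (n * (p ⬝ᵥ p)) :=
          mul_le_mul_of_nonneg_left hpp ((abs_nonneg _).trans hdot)
      _ = n * l1Norm (s - p) * (p ⬝ᵥ p) := by ring
  have h2 : s - c • p = (s - p) + (1 - c) • p := by rw [sub_smul, one_smul]; abel
  have h3 := l1Norm_add_le (s - p) ((1 - c) • p)
  rw [← h2, hp.l1Norm_smul] at h3
  linarith

/-- A pointwise lower bound for the relative entropy. -/
theorem sq_sub_div_four_le {p s : ℝ} (hp : 0 < p) (hp1 : p ≤ 1) (hs : 0 < s) (hs1 : s ≤ 1) :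
    (p - s) ^ 2 / 4 ≤ p * (Real.log p - Real.log s) - p + s := by
  -- With square roots u, w of p, s, the inequality `log x ≤ x - 1` at x = w/u bounds the right side
  -- below by the Hellinger term (u - w)²; the factor 4 is (u + w)² ≤ 4.
  obtain ⟨u, hu, rfl⟩ : ∃ u : ℝ, 0 < u ∧ u ^ 2 = p :=
    ⟨√p, Real.sqrt_pos.mpr hp, Real.sq_sqrt hp.le⟩
  obtain ⟨w, hw, rfl⟩ : ∃ w : ℝ, 0 < w ∧ w ^ 2 = s :=
    ⟨√s, Real.sqrt_pos.mpr hs, Real.sq_sqrt hs.le⟩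
  have hu1 : u ≤ 1 := by nlinarith
  have hw1 : w ≤ 1 := by nlinarith
  have hlog : 1 - w / u ≤ Real.log u - Real.log w := by
    have := Real.log_le_sub_one_of_pos (div_pos hw hu)
    rw [Real.log_div hw.ne' hu.ne'] at this
    linarith
  have h1 : u ^ 2 * (1 - w / u) ≤ u ^ 2 * (Real.log u - Real.log w) :=
    mul_le_mul_of_nonneg_left hlog (sq_nonneg u)
  have h2 : u ^ 2 * (1 - w / u) = u ^ 2 - u * w := by field_simp
  have h3 : (u ^ 2 - w ^ 2) ^ 2 ≤ 4 * (u - w) ^ 2 := by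
    have : (u + w) ^ 2 ≤ 4 := by nlinarith
    calc (u ^ 2 - w ^ 2) ^ 2 = (u + w) ^ 2 * (u - w) ^ 2 := by ring
      _ ≤ 4 * (u - w) ^ 2 := mul_le_mul_of_nonneg_right this (sq_nonneg _)
  rw [Real.log_pow, Real.log_pow]
  push_cast
  nlinarith

/-- A weak form of Pinsker's inequality. -/
theorem sq_l1Norm_sub_le {p s : Fin n → ℝ} (hp : IsPosProb p) (hs : IsPosProb s) :
    l1Norm (s - p) ^ 2 ≤ 4 * n * ∑ a, p a * (Real.log (p a) - Real.log (s a)) := by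
  have h1 : ∑ a, (p a - s a) ^ 2 / 4 ≤ ∑ a, p a * (Real.log (p a) - Real.log (s a)) := by
    have := sum_le_sum fun a (_ : a ∈ univ) =>
      sq_sub_div_four_le (hp.1 a) (hp.le_one a) (hs.1 a) (hs.le_one a)
    rw [sum_add_distrib, sum_sub_distrib, hp.2, hs.2] at this
    linarith
  have h2 := sq_sum_le_card_mul_sum_sq (s := univ) (f := fun a => |(s - p) a|)
  have h3 : ∑ a, |(s - p) a| ^ 2 = 4 * ∑ a, (p a - s a) ^ 2 / 4 := by
    rw [mul_sum]
    refine sum_congr rfl fun a _ => ?_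
    rw [sq_abs, Pi.sub_apply]; ring
  rw [card_univ, Fintype.card_fin, h3] at h2
  calc l1Norm (s - p) ^ 2 ≤ n * (4 * ∑ a, (p a - s a) ^ 2 / 4) := h2
    _ ≤ n * (4 * ∑ a, p a * (Real.log (p a) - Real.log (s a))) := by gcongr
    _ = _ := by ring

end Deviation

/-! ### Termination of the Sinkhorn algorithm. -/

section Sinkhorn

variable {d n : ℕ} {P : Fin d → Fin n → ℝ} {A : Tensor d n}

theorem scale_pos (hA : ∀ i, 0 < A i) (X : Fin d → Fin n → ℝ) (i : Fin d → Fin n) :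
    0 < scale A X i :=
  mul_pos (Real.exp_pos _) (hA i)

theorem scale_update_add (A : Tensor d n) (X : Fin d → Fin n → ℝ) (l : Fin d) (v : Fin n → ℝ) :
    scale A (Function.update X l (v + X l)) = fun i => Real.exp (v (i l)) * scale A X i := by
  funext i
  unfold scale
  rw [← mul_assoc, ← Real.exp_add]
  congr 2
  rw [← add_sum_erase univ _ (mem_univ l), ← add_sum_erase univ (fun j => X j (i j)) (mem_univ l),
    ← add_assoc, Function.update_self, Pi.add_apply]
  congr 1
  refine sum_congr rfl fun j hj => ?_
  rw [Function.update_of_ne (ne_of_mem_erase hj)]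

theorem isPosProb_marginal {F : Tensor d n} (hF : ∀ i, 0 < F i) (hF1 : ∑ i, F i = 1) (j : Fin d) :
    IsPosProb (marginal j F) :=
  ⟨marginal_pos j hF, by rw [sum_marginal, hF1]⟩

variable {X : ℕ → Fin d → Fin n → ℝ} {ℓ : ℕ → Fin d}

/-- After a step the rescaled mode has marginal exactly p_l, hence total mass one. -/
theorem IsSinkhornRun.sum_scale (hrun : IsSinkhornRun P A X ℓ) (hP : ∀ j, IsPosProb (P j))
    (hA : ∀ i, 0 < A i) (hA1 : ∑ i, A i = 1) (k : ℕ) : ∑ i, scale A (X k) i = 1 := by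
  cases k with
  | zero => simp [scale, hrun.init, hA1]
  | succ k =>
    rw [hrun.step, scale_update_add, ← sum_marginal (ℓ k), ← (hP (ℓ k)).2]
    refine sum_congr rfl fun a _ => ?_
    have hm := marginal_pos (ℓ k) (scale_pos hA (X k)) a
    rw [marginal_comp_mul (ℓ k) (fun b => Real.exp (logRatio P (scale A (X k)) (ℓ k) b)), logRatio,
      Real.exp_sub, Real.exp_log ((hP _).1 a), Real.exp_log hm, div_mul_cancel₀ _ hm.ne']

/-- The dual objective increases in a step of the algorithm by a relative entropy. -/
theorem IsSinkhornRun.dual_step (hrun : IsSinkhornRun P A X ℓ) (k : ℕ) :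
    ∑ j, ∑ a, P j a * X (k + 1) j a = ∑ j, ∑ a, P j a * X k j a +
      ∑ a, P (ℓ k) a * (Real.log (P (ℓ k) a) - Real.log (marginal (ℓ k) (scale A (X k)) a)) := by
  rw [← add_sum_erase univ _ (mem_univ (ℓ k)),
    ← add_sum_erase univ (fun j => ∑ a, P j a * X k j a) (mem_univ (ℓ k)), hrun.step k,
    Function.update_self]
  have h : ∀ j ∈ univ.erase (ℓ k), ∑ a, P j a * Function.update (X k) (ℓ k)
      (logRatio P (scale A (X k)) (ℓ k) + X k (ℓ k)) j a = ∑ a, P j a * X k j a := fun j hj => by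
    rw [Function.update_of_ne (ne_of_mem_erase hj)]
  rw [sum_congr rfl h]
  simp only [Pi.add_apply, logRatio, mul_add, sum_add_distrib]
  ring

/-- The dual objective is bounded along normalized scalings. -/
theorem dual_le (hP : ∀ j, IsPosProb (P j)) [NeZero d] (hA : ∀ i, 0 < A i) {Y : Fin d → Fin n → ℝ}
    (hY : ∑ i, scale A Y i = 1) :
    ∑ j, ∑ a, P j a * Y j a ≤ ∑ i, (∏ j, P j (i j)) * -Real.log (A i) := by
  have hU := prod_mem_polytope hP
  have h := sum_mul_separable (fun i => ∏ j, P j (i j)) Y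
  simp only [hU.2] at h
  rw [← h]
  refine sum_le_sum fun i _ => mul_le_mul_of_nonneg_left ?_ (hU.1 i)
  have h1 : scale A Y i ≤ 1 :=
    hY ▸ single_le_sum (fun k _ => (scale_pos hA Y k).le) (mem_univ i)
  have h2 := Real.log_nonpos (scale_pos hA Y i).le h1
  rw [scale, Real.log_mul (Real.exp_pos _).ne' (hA i).ne', Real.log_exp] at h2
  linarith

/-- The Sinkhorn algorithm stops. -/
theorem IsSinkhornRun.exists_stopsAt [NeZero d] (hrun : IsSinkhornRun P A X ℓ)
    (hP : ∀ j, IsPosProb (P j)) (hA : ∀ i, 0 < A i) (hA1 : ∑ i, A i = 1) {ε : ℝ} (hε : 0 < ε) :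
    ∃ k, StopsAt P ε (scale A (X k)) := by
  by_contra hno
  have hbig : ∀ k, ε ≤ deviation P (scale A (X k)) (ℓ k) := fun k => by
    by_contra hk
    exact hno ⟨k, fun j => (hrun.argmax k j).trans_lt (not_le.mp hk)⟩
  have hn : 0 < n := by
    rcases Nat.eq_zero_or_pos n with rfl | h
    · have := (hP 0).2
      simp at this
    · exact h
  have hn' : (0 : ℝ) < n := Nat.cast_pos.mpr hn
  -- Guaranteed gain per step: distance at least ε / (1 + n), inserted in the weak Pinsker
  -- inequality.
  set c : ℝ := (ε / (1 + n)) ^ 2 / (4 * n) with hc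
  have hc0 : 0 < c := by positivity
  set g : ℕ → ℝ := fun k => ∑ j, ∑ a, P j a * X k j a with hg
  have hstep : ∀ k, g k + c ≤ g (k + 1) := fun k => by
    have hs := isPosProb_marginal (scale_pos hA (X k)) (hrun.sum_scale hP hA hA1 k) (ℓ k)
    have h1 : ε / (1 + n) ≤ l1Norm (marginal (ℓ k) (scale A (X k)) - P (ℓ k)) := by
      rw [div_le_iff₀' (by positivity)]
      exact (hbig k).trans (l1Norm_sub_proj_le (hP (ℓ k)))
    have h2 := (pow_le_pow_left₀ (by positivity) h1 2).trans (sq_l1Norm_sub_le (hP (ℓ k)) hs)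
    have h3 := hrun.dual_step k
    rw [hg]
    simp only
    rw [h3]
    gcongr
    rw [hc, div_le_iff₀' (by positivity)]
    exact h2
  have hgrow : ∀ k : ℕ, g 0 + k * c ≤ g k := fun k => by
    induction k with
    | zero => simp
    | succ k ih =>
      have := hstep k
      push_cast
      linarith
  obtain ⟨k, hk⟩ := exists_nat_gt ((∑ i, (∏ j, P j (i j)) * -Real.log (A i) - g 0) / c)
  rw [div_lt_iff₀ hc0] at hk
  have h1 := hgrow k
  have h2 : g k ≤ _ := dual_le hP hA (hrun.sum_scale hP hA hA1 k)
  linarith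

end Sinkhorn

/-! ### Entropy and near-optimality of scalings. -/

section Entropy

variable {d n : ℕ}

/-- The entropy of a positive probability tensor is at most the logarithm of the number of its
entries. -/
theorem neg_sum_mul_log_le (hn : 0 < n) {F : Tensor d n} (hF : ∀ i, 0 < F i)
    (hF1 : ∑ i, F i = 1) : -∑ i, F i * Real.log (F i) ≤ d * Real.log n := by
  have hN : (0 : ℝ) < (n : ℝ) ^ d := by positivity
  have h : ∀ i, -(F i * Real.log (F i)) ≤ F i * (d * Real.log n) + (1 / (n : ℝ) ^ d - F i) :=
    fun i => by
    -- This is `log x ≤ x - 1` at x = 1 / (F i · n^d), comparing F with the uniform tensor.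
    have h1 := Real.log_le_sub_one_of_pos (div_pos (inv_pos.mpr (hF i)) hN)
    rw [Real.log_div (inv_pos.mpr (hF i)).ne' hN.ne', Real.log_inv, Real.log_pow] at h1
    have h2 := mul_le_mul_of_nonneg_left h1 (hF i).le
    have h3 : F i * ((F i)⁻¹ / (n : ℝ) ^ d - 1) = 1 / (n : ℝ) ^ d - F i := by
      have := (hF i).ne'
      field_simp
    linarith
  have hsum := sum_le_sum fun i (_ : i ∈ univ) => h i
  rw [sum_neg_distrib, sum_add_distrib, ← sum_mul, sum_sub_distrib, hF1, sum_const, card_univ,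
    Fintype.card_pi, nsmul_eq_mul] at hsum
  simp only [Fintype.card_fin, prod_const, card_univ, Nat.cast_pow] at hsum
  rw [mul_one_div_cancel hN.ne'] at hsum
  linarith

/-- A normalized scaling of `exp(-λ C)` is optimal up to `d log n / λ` among the nonnegative tensors
with the same marginals. -/
theorem pairing_scale_le (hn : 0 < n) {C : Tensor d n} {lam c : ℝ} (hlam : 0 < lam) (hc : 0 < c)
    {A : Tensor d n} (hA : A = c • texp (-lam • C)) {Y : Fin d → Fin n → ℝ}
    (hY : ∑ i, scale A Y i = 1) {U : Tensor d n} (hU : ∀ i, 0 ≤ U i) (hU1 : ∑ i, U i = 1)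
    (hUY : ∀ j, marginal j U = marginal j (scale A Y)) :
    pairing C (scale A Y) ≤ pairing C U + d * Real.log n / lam := by
  have hApos : ∀ i, 0 < A i := fun i => by
    rw [hA]; exact mul_pos hc (Real.exp_pos _)
  set F := scale A Y with hF
  have hF0 : ∀ i, 0 < F i := scale_pos hApos Y
  have hlog : ∀ i, Real.log (F i) = ∑ j, Y j (i j) + Real.log c - lam * C i := fun i => by
    have hi : F i = Real.exp (∑ j, Y j (i j)) * (c * Real.exp (-lam * C i)) := by
      rw [hF, hA]; rfl
    rw [hi, Real.log_mul (Real.exp_pos _).ne' (mul_pos hc (Real.exp_pos _)).ne',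
      Real.log_exp, Real.log_mul hc.ne' (Real.exp_pos _).ne', Real.log_exp]
    ring
  have hint : ∀ V : Tensor d n, ∑ i, V i = 1 → ∑ i, V i * Real.log (F i) =
      ∑ j, ∑ a, marginal j V a * Y j a + Real.log c - lam * pairing C V := fun V hV => by
    have : ∀ i, V i * Real.log (F i) =
        V i * (∑ j, Y j (i j)) + V i * Real.log c - lam * (C i * V i) := fun i => by
      rw [hlog]; ring
    rw [sum_congr rfl fun i _ => this i, sum_sub_distrib, sum_add_distrib, sum_mul_separable,
      ← sum_mul, hV, one_mul, ← mul_sum, pairing]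
  have h1 := hint F hY
  have h2 := hint U hU1
  simp only [hUY] at h2
  -- Entries of F are at most one, so only the sign of log F matters and U may have zero entries.
  have h3 : ∑ i, U i * Real.log (F i) ≤ 0 := sum_nonpos fun i _ =>
    mul_nonpos_of_nonneg_of_nonpos (hU i) (Real.log_nonpos (hF0 i).le
      (hY ▸ single_le_sum (fun k _ => (hF0 k).le) (mem_univ i)))
  have h4 := neg_sum_mul_log_le hn hF0 hY
  have h5 : lam * (pairing C F - pairing C U) ≤ d * Real.log n := by linarith
  rw [← sub_le_iff_le_add', le_div_iff₀' hlam]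
  exact h5

end Entropy

end TensorOT

/-! ### The approximation bound. -/

theorem mainTheorem4 {d n : ℕ} [NeZero d] (P : Fin d → Fin n → ℝ)
    (hP : ∀ j, TensorOT.IsPosProb (P j)) (C : TensorOT.Tensor d n)
    (hnC : 2 ≤ n ∨ C ≠ 0) (lam : ℝ) (hlam : 0 < lam)
    (ε : ℝ) (hε0 : 0 < ε) (hε : ε < 1 / 2)
    (A : TensorOT.Tensor d n) (hA : A = TensorOT.texp (-lam • C))
    (A₀ : TensorOT.Tensor d n) (hA₀ : A₀ = (1 / TensorOT.l1Norm A) • A)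
    (X : ℕ → Fin d → Fin n → ℝ) (ℓ : ℕ → Fin d)
    (hrun : TensorOT.IsSinkhornRun P A₀ X ℓ) :
    ∃ K : ℕ,
      IsLeast {k : ℕ | TensorOT.StopsAt P ε (TensorOT.scale A₀ (X k))} K ∧
      TensorOT.replacement P (TensorOT.scale A₀ (X K)) ∈ TensorOT.polytope P ∧
      TensorOT.pairing C (TensorOT.replacement P (TensorOT.scale A₀ (X K))) <
        TensorOT.otValue C P + (d : ℝ) * Real.log (n : ℝ) / lam + 8 * (d : ℝ) * ‖C‖ * ε := by
  have hd : (1 : ℝ) ≤ d := by exact_mod_cast NeZero.one_le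
  have hn : 0 < n := by
    rcases Nat.eq_zero_or_pos n with rfl | h
    · have := (hP 0).2
      simp at this
    · exact h
  have hne : Nonempty (Fin d → Fin n) := ⟨fun _ => ⟨0, hn⟩⟩
  have hApos : ∀ i, 0 < A i := fun i => by rw [hA]; exact Real.exp_pos _
  have hl1 : TensorOT.l1Norm A = ∑ i, A i := Finset.sum_congr rfl fun i _ => abs_of_pos (hApos i)
  have hl1pos : 0 < TensorOT.l1Norm A := by
    rw [hl1]; exact Finset.sum_pos (fun i _ => hApos i) Finset.univ_nonempty
  have hA₀pos : ∀ i, 0 < A₀ i := fun i => by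
    rw [hA₀]; exact mul_pos (one_div_pos.mpr hl1pos) (hApos i)
  have hA₀1 : ∑ i, A₀ i = 1 := by
    rw [hA₀]
    simp only [Pi.smul_apply, smul_eq_mul]
    rw [← Finset.mul_sum, ← hl1, one_div_mul_cancel hl1pos.ne']
  classical
  have hex := hrun.exists_stopsAt hP hA₀pos hA₀1 hε0
  refine ⟨Nat.find hex, ⟨Nat.find_spec hex, fun k hk => Nat.find_min' hex hk⟩, ?_⟩
  have h_dev := Nat.find_spec hex
  set F := TensorOT.scale A₀ (X (Nat.find hex)) with hF
  have hFpos : ∀ i, 0 < F i := TensorOT.scale_pos hA₀pos _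
  have hF1 : ∑ i, F i = 1 := hrun.sum_scale hP hA₀pos hA₀1 _
  have hQ : ∀ j, TensorOT.IsPosProb (TensorOT.marginal j F) :=
    TensorOT.isPosProb_marginal hFpos hF1
  have hη : ∀ j, TensorOT.l1Norm (TensorOT.marginal j F - P j) ≤ 2 * ε := fun j =>
    (TensorOT.l1Norm_sub_le_two_mul (hP j) (hQ j).2 _).trans (by
      have : TensorOT.deviation P F j < ε := h_dev j
      exact mul_le_mul_of_nonneg_left this.le zero_le_two)
  obtain ⟨hB, hBF⟩ := TensorOT.replacement_spec hP (fun i => (hFpos i).le) hF1 hη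
  refine ⟨hB, ?_⟩
  obtain ⟨U, hU, hUτ⟩ := (TensorOT.isLeast_otValue C hP).1
  have hU1 : ∑ i, U i = 1 := by rw [← TensorOT.sum_marginal 0, hU.2 0, (hP 0).2]
  -- Replacement with the roles exchanged: the target marginals are those of F, the input is the
  -- optimal U.
  obtain ⟨hV, hVU⟩ := TensorOT.replacement_spec (F := U) (η := 2 * ε) hQ hU.1 hU1 fun j => by
    rw [hU.2 j, TensorOT.l1Norm_sub_comm]; exact hη j
  set V := TensorOT.replacement (fun j => TensorOT.marginal j F) U
  have hV1 : ∑ i, V i = 1 := by rw [← TensorOT.sum_marginal 0, hV.2 0, (hQ 0).2]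
  have h1 := TensorOT.pairing_scale_le hn hlam (one_div_pos.mpr hl1pos) (by rw [hA₀, ← hA]) hF1
    hV.1 hV1 hV.2
  have h2 := TensorOT.pairing_sub_le C (TensorOT.replacement P F) F
  have h3 := TensorOT.pairing_sub_le C V U
  have h4 := mul_le_mul_of_nonneg_left hBF (norm_nonneg C)
  have h5 := mul_le_mul_of_nonneg_left hVU (norm_nonneg C)
  -- The estimates give error 4d‖C‖ε. Strictness comes from the spare 4d‖C‖ε if C ≠ 0, and from log
  -- n > 0 if C = 0.
  rcases hnC with hn2 | hC
  · have hpos : 0 < (d : ℝ) * Real.log n / lam :=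
      div_pos (mul_pos (by linarith) (Real.log_pos (by exact_mod_cast hn2))) hlam
    rcases eq_or_ne C 0 with rfl | hC
    · have h0 : ∀ W : TensorOT.Tensor d n, TensorOT.pairing 0 W = 0 := fun W => by
        simp [TensorOT.pairing]
      rw [← hUτ, h0, h0, norm_zero]
      linarith
    · have : 0 < (d : ℝ) * ‖C‖ * ε :=
        mul_pos (mul_pos (by linarith) (norm_pos_iff.mpr hC)) hε0
      linarith
  · have : 0 < (d : ℝ) * ‖C‖ * ε :=
      mul_pos (mul_pos (by linarith) (norm_pos_iff.mpr hC)) hε0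
    linarith
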